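/- Let $d \ge 2$ and $k \ge 1$ be integers. A *polytope* is the convex hull of a finite set of points of $\mathbb{R}^d$; write $\mathcal{V}(P)$ for the set of vertices of a polytope $P$. If $P \subset \mathbb{R}^d$ is a $d$-dimensional polytope, a point $x \in \mathbb{R}^d \setminus P$ *can be inserted* in $P$ if the vertex set of $\mathrm{conv}(P \cup \{x\})$ is exactly $\mathcal{V}(P) \cup \{x\}$, and the corresponding *insertion move* transforms $P$ into $\mathrm{conv}(P \cup \{x\})$. A vertex $v \in \mathcal{V}(P)$ *can be deleted* from $P$ if $\mathrm{conv}(\mathcal{V}(P) \setminus \{v\})$ is $d$-dimensional, and the corresponding *deletion move* transforms $P$ into $\mathrm{conv}(\mathcal{V}(P) \setminus \{v\})$. Let $\Lambda(d,k)$ be the graph whose vertices are the $d$-dimensional polytopes contained in the hypercube $[0,k]^d$ all of whose vertices belong to $\mathbb{Z}^d$, and in which two polytopes are adjacent when one is obtained from the other by an insertion move or a deletion move. Then $\Lambda(d,k)$ is connected: it has at least one vertex, and any two of its vertices are joined by a path. -/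

import Mathlib

/-- A convex polytope in `ℝ^d`: the convex hull of a finite set of points. -/
def IsPolytope {d : ℕ} (P : Set (Fin d → ℝ)) : Prop :=
  ∃ A : Set (Fin d → ℝ), A.Finite ∧ P = convexHull ℝ A

/-- The vertex set of a polytope: its extreme points. -/
def vertexSet {d : ℕ} (P : Set (Fin d → ℝ)) : Set (Fin d → ℝ) :=
  P.extremePoints ℝ

/-- A subset of `ℝ^d` is `d`-dimensional when its affine hull is all of `ℝ^d`. -/
def IsFullDim {d : ℕ} (P : Set (Fin d → ℝ)) : Prop :=
  affineSpan ℝ P = ⊤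

/-- The `d`-dimensional polytopes contained in `ℝ^d`. -/
def FullPolytope (d : ℕ) : Type :=
  {P : Set (Fin d → ℝ) // IsPolytope P ∧ IsFullDim P}

/-- The point `x`, outside of `P`, can be inserted in `P`: the vertices of the convex hull of
`P ∪ {x}` are exactly the vertices of `P` and `x`. -/
def CanInsert {d : ℕ} (P : Set (Fin d → ℝ)) (x : Fin d → ℝ) : Prop :=
  x ∉ P ∧ vertexSet (convexHull ℝ (P ∪ {x})) = vertexSet P ∪ {x}

/-- The vertex `v` of `P` can be deleted from `P`: the convex hull of the other vertices of `P`
is still `d`-dimensional. -/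
def CanDelete {d : ℕ} (P : Set (Fin d → ℝ)) (v : Fin d → ℝ) : Prop :=
  v ∈ vertexSet P ∧ IsFullDim (convexHull ℝ (vertexSet P \ {v}))

/-- `Q` is obtained from `P` by an insertion move. -/
def IsInsertionMove {d : ℕ} (P Q : Set (Fin d → ℝ)) : Prop :=
  ∃ x, CanInsert P x ∧ Q = convexHull ℝ (P ∪ {x})

/-- `Q` is obtained from `P` by a deletion move. -/
def IsDeletionMove {d : ℕ} (P Q : Set (Fin d → ℝ)) : Prop :=
  ∃ v, CanDelete P v ∧ Q = convexHull ℝ (vertexSet P \ {v})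

/-- The graph on the `d`-dimensional polytopes of `ℝ^d` in which two distinct polytopes are
adjacent when one is obtained from the other by an insertion move or a deletion move. -/
def polytopeGraph (d : ℕ) : SimpleGraph (FullPolytope d) :=
  SimpleGraph.fromRel fun P Q => IsInsertionMove P.1 Q.1 ∨ IsDeletionMove P.1 Q.1

/-- All vertices of `P` belong to the lattice `ℤ^d`. -/
def IsLatticePolytope {d : ℕ} (P : Set (Fin d → ℝ)) : Prop :=
  ∀ v ∈ vertexSet P, ∃ z : Fin d → ℤ, v = fun i => (z i : ℝ)

/-- The hypercube `[0,k]^d`. -/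
def hypercube (d k : ℕ) : Set (Fin d → ℝ) :=
  {x | ∀ i, 0 ≤ x i ∧ x i ≤ (k : ℝ)}

/-- The graph `Λ(d,k)`: the subgraph induced by the lattice polytopes contained in `[0,k]^d`. -/
def latticePolytopeGraph (d k : ℕ) :
    SimpleGraph {P : FullPolytope d | IsLatticePolytope P.1 ∧ P.1 ⊆ hypercube d k} :=
  (polytopeGraph d).induce {P : FullPolytope d | IsLatticePolytope P.1 ∧ P.1 ⊆ hypercube d k}

/-!
A polytope is its vertex set, and two vertex sets whose union is in convex position are joined by a
path: insert the points of one, then delete the points of the other. Every full-dimensional vertex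
set contains the vertices of a simplex, so it is enough to join a simplex to the hypercube.

Sliding a vertex of a simplex along a coordinate axis `e` multiplies the slopes along `e` of all the
barycentric coordinates by a common factor. Hence the pattern of their signs survives, up to a
global change of sign, while the vertices are slid one after the other. If at least two slopes are
positive and at least two are negative, each vertex can be slid onto one of the two facets of the
hypercube orthogonal to `e`. Otherwise, up to replacing `e` by `-e`, exactly one slope is positive;
the other vertices can then be slid into a common hyperplane orthogonal to `e`, which turns the
simplex into a pyramid over a set in that hyperplane.

The apex of a pyramid can be moved to a corner of the hypercube, then replaced by all the corners of
a facet parallel to the base; a pyramid over that facet is in turn joined to the hypercube. If no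
axis produces a pyramid, the slides along all the axes bring the vertices to corners of the
hypercube.
-/

section ConvexPosition

variable {𝕜 E : Type*} [Field 𝕜] [LinearOrder 𝕜] [AddCommGroup E] [Module 𝕜 E]
  {A B W : Set E} {f g : E →ₗ[𝕜] 𝕜} {c s t : 𝕜} {v p q : E}

theorem convexIndependent_of_affineIndependent {ι : Type*} {b : ι → E}
    (hb : AffineIndependent 𝕜 b) : ConvexIndependent 𝕜 b :=
  convexIndependent_iff_notMem_convexHull_sdiff.2 fun j s h =>
    hb.notMem_affineSpan_sdiff j s (convexHull_subset_affineSpan _ h)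

theorem convexIndependent_pair (hpq : p ≠ q) :
    ConvexIndependent 𝕜 ((↑) : ↥({p, q} : Set E) → E) := by
  rw [convexIndependent_set_iff_notMem_convexHull_sdiff]
  rintro v (rfl | rfl)
  · simp [hpq]
  · simp [Set.pair_comm, hpq.symm]

variable [IsStrictOrderedRing 𝕜]

theorem mem_convexHull_face (hW : ∀ w ∈ W, f w ≤ c) (hv : v ∈ convexHull 𝕜 W) (hvc : f v = c) :
    v ∈ convexHull 𝕜 {w ∈ W | f w = c} := by
  set F := convexHull 𝕜 {w ∈ W | f w = c}
  have hconv : Convex 𝕜 {x | f x ≤ c ∧ (f x = c → x ∈ F)} := by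
    rw [convex_iff_forall_pos]
    rintro x ⟨hx, hxF⟩ y ⟨hy, hyF⟩ a b ha hb hab
    have hc : c = a * c + b * c := by rw [← add_mul, hab, one_mul]
    have hax := mul_le_mul_of_nonneg_left hx ha.le
    have hby := mul_le_mul_of_nonneg_left hy hb.le
    simp only [Set.mem_ofPred_eq, map_add, map_smul, smul_eq_mul]
    refine ⟨by linarith, fun h => ?_⟩
    have hxc : f x = c := mul_left_cancel₀ ha.ne' (by linarith)
    have hyc : f y = c := mul_left_cancel₀ hb.ne' (by linarith)
    exact convex_convexHull 𝕜 _ (hxF hxc) (hyF hyc) ha.le hb.le hab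
  refine (convexHull_min ?_ hconv hv).2 hvc
  exact fun w hw => ⟨hW w hw, fun h => subset_convexHull 𝕜 _ ⟨hw, h⟩⟩

theorem eq_of_mem_convexHull (hA : ∀ a ∈ A, f a = s) (hv : v ∈ convexHull 𝕜 A) : f v = s :=
  convexHull_min hA (convex_hyperplane f.isLinear s) hv

theorem notMem_convexHull_of_pos {φ : E →ᵃ[𝕜] 𝕜} (hW : ∀ w ∈ W, φ w ≤ 0) (hv : 0 < φ v) :
    v ∉ convexHull 𝕜 W := fun h =>
  hv.not_ge (convexHull_min hW ((convex_Iic (0 : 𝕜)).affine_preimage φ) h)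

theorem notMem_convexHull_union_sdiff_of_layer (hA : ∀ a ∈ A, f a = c) (hB : ∀ b ∈ B, f b < c)
    (hAi : ConvexIndependent 𝕜 ((↑) : A → E)) (hv : v ∈ A) :
    v ∉ convexHull 𝕜 ((A ∪ B) \ {v}) := by
  intro h
  have hface := mem_convexHull_face (f := f) (c := c) (by grind) h (hA v hv)
  exact convexIndependent_set_iff_notMem_convexHull_sdiff.1 hAi v hv
    (convexHull_mono (by grind) hface)

theorem convexIndependent_union_of_layers (hst : s ≠ t) (hA : ∀ a ∈ A, f a = s)
    (hB : ∀ b ∈ B, f b = t) (hAi : ConvexIndependent 𝕜 ((↑) : A → E))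
    (hBi : ConvexIndependent 𝕜 ((↑) : B → E)) :
    ConvexIndependent 𝕜 ((↑) : ↥(A ∪ B) → E) := by
  have hpos : 0 < (s - t) * (s - t) := mul_self_pos.2 (sub_ne_zero.2 hst)
  rw [convexIndependent_set_iff_notMem_convexHull_sdiff]
  rintro v (hv | hv)
  · refine notMem_convexHull_union_sdiff_of_layer (f := (s - t) • f) (c := (s - t) * s)
      (fun a ha => ?_) (fun b hb => ?_) hAi hv
    · simp [hA a ha]
    · simp only [LinearMap.smul_apply, smul_eq_mul, hB b hb]
      linarith
  · rw [Set.union_comm]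
    refine notMem_convexHull_union_sdiff_of_layer (f := (t - s) • f) (c := (t - s) * t)
      (fun b hb => ?_) (fun a ha => ?_) hBi hv
    · simp [hB b hb]
    · simp only [LinearMap.smul_apply, smul_eq_mul, hA a ha]
      linarith

theorem notMem_convexHull_of_forall_ge (hA : ∀ a ∈ A, f a = s) (hp : f p ≠ s)
    (hgA : ∀ a ∈ A, g p ≤ g a) (hgq : g p < g q) :
    p ∉ convexHull 𝕜 (insert q A) := by
  intro h
  have hface := mem_convexHull_face (f := -g) (c := -g p) (by
    rintro w (rfl | hw)
    · exact neg_le_neg hgq.le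
    · exact neg_le_neg (hgA w hw)) h rfl
  refine hp (eq_of_mem_convexHull ?_ hface)
  rintro w ⟨rfl | hw, hwp⟩
  · exact absurd (neg_injective hwp) hgq.ne'
  · exact hA w hw

theorem convexIndependent_union_pair (hA : ∀ a ∈ A, f a = s)
    (hAi : ConvexIndependent 𝕜 ((↑) : A → E)) (hpq : 0 < (f p - s) * (f q - s))
    (hgp : ∀ a ∈ A, g p ≤ g a) (hgq : ∀ a ∈ A, g a ≤ g q) (hlt : g p < g q) :
    ConvexIndependent 𝕜 ((↑) : ↥(A ∪ {p, q}) → E) := by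
  have hp : f p ≠ s := fun h => by simp [h] at hpq
  have hq : f q ≠ s := fun h => by simp [h] at hpq
  have hpp : 0 < (f p - s) * (f p - s) := mul_self_pos.2 (sub_ne_zero.2 hp)
  rw [convexIndependent_set_iff_notMem_convexHull_sdiff]
  rintro v (hv | rfl | rfl)
  · refine notMem_convexHull_union_sdiff_of_layer (f := (s - f p) • f) (c := (s - f p) * s)
      (fun a ha => ?_) ?_ hAi hv
    · simp [hA a ha]
    · rintro w (rfl | rfl) <;> simp only [LinearMap.smul_apply, smul_eq_mul] <;> linarith
  · exact fun h => notMem_convexHull_of_forall_ge hA hp hgp hlt (convexHull_mono (by grind) h)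
  · exact fun h => notMem_convexHull_of_forall_ge (g := -g) hA hq
      (fun a ha => neg_le_neg (hgq a ha)) (neg_lt_neg hlt) (convexHull_mono (by grind) h)

end ConvexPosition

section AffineSpan

variable {𝕜 E : Type*} [Field 𝕜] [AddCommGroup E] [Module 𝕜 E] {A V W : Set E}
  {f : E →ₗ[𝕜] 𝕜} {s : 𝕜} {v w : E}

theorem affineSpan_eq_top_mono (hVW : V ⊆ W) (hV : affineSpan 𝕜 V = ⊤) : affineSpan 𝕜 W = ⊤ :=
  top_le_iff.1 (hV ▸ affineSpan_mono 𝕜 hVW)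

theorem eq_of_mem_affineSpan (hA : ∀ a ∈ A, f a = s) (hv : v ∈ affineSpan 𝕜 A) : f v = s :=
  AffineMap.eqOn_affineSpan (f := f.toAffineMap) (g := AffineMap.const 𝕜 E s) hA hv

theorem exists_mem_apply_ne (hf : f ≠ 0) (hV : affineSpan 𝕜 V = ⊤) (s : 𝕜) :
    ∃ v ∈ V, f v ≠ s := by
  by_contra! h
  have hs (x : E) : f x = s := eq_of_mem_affineSpan h (hV ▸ AffineSubspace.mem_top 𝕜 E x)
  exact hf (LinearMap.ext fun x => by rw [hs x, ← hs 0, map_zero, LinearMap.zero_apply])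

theorem nonempty_of_affineSpan_insert_eq_top [Nontrivial E]
    (hv : affineSpan 𝕜 (insert v A) = ⊤) : A.Nonempty := by
  rw [Set.nonempty_iff_ne_empty]
  rintro rfl
  exact not_subsingleton E
    (AffineSubspace.subsingleton_of_subsingleton_span_eq_top (by simp) hv)

theorem affineSpan_insert_eq_top_of_layer [Nontrivial E] (hA : ∀ a ∈ A, f a = s)
    (hv : affineSpan 𝕜 (insert v A) = ⊤) (hw : f w ≠ s) : affineSpan 𝕜 (insert w A) = ⊤ := by
  obtain ⟨u, hu⟩ := nonempty_of_affineSpan_insert_eq_top hv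
  have huA : u ∈ affineSpan 𝕜 A := subset_affineSpan 𝕜 _ hu
  have hwv : w ∈ affineSpan 𝕜 (insert v (affineSpan 𝕜 A : Set E)) := by
    rw [affineSpan_insert_affineSpan, hv]
    trivial
  obtain ⟨r, a, ha, hwa⟩ := (AffineSubspace.mem_affineSpan_insert_iff huA v w).1 hwv
  simp only [vsub_eq_sub, vadd_eq_add] at hwa
  have hr : r ≠ 0 := by
    rintro rfl
    exact hw (by rw [hwa, zero_smul, zero_add, eq_of_mem_affineSpan hA ha])
  have hmem : v ∈ affineSpan 𝕜 (insert w (affineSpan 𝕜 A : Set E)) := by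
    refine (AffineSubspace.mem_affineSpan_insert_iff ha w v).2 ⟨r⁻¹, u, huA, ?_⟩
    simp [hwa, smul_smul, inv_mul_cancel₀ hr]
  rw [affineSpan_insert_affineSpan] at hmem
  rw [eq_top_iff, ← hv]
  exact affineSpan_le.2 (Set.insert_subset hmem
    ((Set.subset_insert _ _).trans (subset_affineSpan 𝕜 _)))

end AffineSpan

/-- A subset `V` of `S` that is the vertex set of a full-dimensional polytope: its points are in
convex position and affinely span the space. -/
structure IsFullVertexSet (𝕜 : Type*) {E : Type*} [Field 𝕜] [PartialOrder 𝕜] [AddCommGroup E]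
    [Module 𝕜 E] (S V : Set E) : Prop where
  subset : V ⊆ S
  convexIndependent : ConvexIndependent 𝕜 ((↑) : V → E)
  affineSpan_eq_top : affineSpan 𝕜 V = ⊤

/-- Two vertex sets are compatible when their union is in convex position, so that one turns into
the other by inserting the points of the second and then deleting the points of the first. -/
structure VertexCompatible (𝕜 : Type*) {E : Type*} [Field 𝕜] [PartialOrder 𝕜] [AddCommGroup E]
    [Module 𝕜 E] (S U V : Set E) : Prop where
  union : IsFullVertexSet 𝕜 S (U ∪ V)
  affineSpan_left : affineSpan 𝕜 U = ⊤
  affineSpan_right : affineSpan 𝕜 V = ⊤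

/-- Two vertex sets are linked when they are joined by a chain of compatible vertex sets. This is
the convex-geometric counterpart of reachability in the graph of insertion and deletion moves. -/
def Linked (𝕜 : Type*) {E : Type*} [Field 𝕜] [PartialOrder 𝕜] [AddCommGroup E] [Module 𝕜 E]
    (S : Set E) : Set E → Set E → Prop :=
  Relation.TransGen (VertexCompatible 𝕜 S)

section Linked

variable {𝕜 E : Type*} [Field 𝕜] [LinearOrder 𝕜] [AddCommGroup E] [Module 𝕜 E]
  {A S U V W : Set E} {f g : E →ₗ[𝕜] 𝕜} {s : 𝕜} {p q v : E}

namespace IsFullVertexSet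

theorem mono (hW : IsFullVertexSet 𝕜 S W) (hVW : V ⊆ W) (hV : affineSpan 𝕜 V = ⊤) :
    IsFullVertexSet 𝕜 S V where
  subset := hVW.trans hW.subset
  convexIndependent := hW.convexIndependent.mono hVW
  affineSpan_eq_top := hV

end IsFullVertexSet

namespace VertexCompatible

theorem of_subset (hW : IsFullVertexSet 𝕜 S W) (hUW : U ⊆ W) (hVW : V ⊆ W)
    (hU : affineSpan 𝕜 U = ⊤) (hV : affineSpan 𝕜 V = ⊤) : VertexCompatible 𝕜 S U V where
  union := hW.mono (Set.union_subset hUW hVW) (affineSpan_eq_top_mono Set.subset_union_left hU)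
  affineSpan_left := hU
  affineSpan_right := hV

theorem symm (h : VertexCompatible 𝕜 S U V) : VertexCompatible 𝕜 S V U :=
  of_subset h.union Set.subset_union_right Set.subset_union_left h.affineSpan_right
    h.affineSpan_left

theorem left (h : VertexCompatible 𝕜 S U V) : IsFullVertexSet 𝕜 S U :=
  h.union.mono Set.subset_union_left h.affineSpan_left

end VertexCompatible

namespace Linked

theorem of_subset (hW : IsFullVertexSet 𝕜 S W) (hUW : U ⊆ W) (hVW : V ⊆ W)
    (hU : affineSpan 𝕜 U = ⊤) (hV : affineSpan 𝕜 V = ⊤) : Linked 𝕜 S U V :=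
  .single (.of_subset hW hUW hVW hU hV)

theorem refl (hV : IsFullVertexSet 𝕜 S V) : Linked 𝕜 S V V :=
  of_subset hV subset_rfl subset_rfl hV.affineSpan_eq_top hV.affineSpan_eq_top

theorem symm (h : Linked 𝕜 S U V) : Linked 𝕜 S V U :=
  (@Relation.TransGen.stdSymm _ _ ⟨fun _ _ => VertexCompatible.symm⟩).symm _ _ h

theorem trans (hUV : Linked 𝕜 S U V) (hVW : Linked 𝕜 S V W) : Linked 𝕜 S U W :=
  Relation.TransGen.trans hUV hVW

theorem left (h : Linked 𝕜 S U V) : IsFullVertexSet 𝕜 S U := by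
  obtain ⟨_, hU, -⟩ := Relation.TransGen.head'_iff.1 h
  exact hU.left

theorem right (h : Linked 𝕜 S U V) : IsFullVertexSet 𝕜 S V :=
  h.symm.left

end Linked

theorem exists_linked_range (hV : IsFullVertexSet 𝕜 S V) :
    ∃ (W : Set E) (b : AffineBasis W 𝕜 E), Linked 𝕜 S V (Set.range b) := by
  obtain ⟨W, hWV, hspan, hind⟩ := exists_affineIndependent 𝕜 E V
  rw [hV.affineSpan_eq_top] at hspan
  let b : AffineBasis W 𝕜 E := ⟨((↑) : W → E), hind, by rwa [Subtype.range_coe]⟩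
  exact ⟨W, b, .of_subset hV subset_rfl (Subtype.range_coe.subset.trans hWV)
    hV.affineSpan_eq_top b.tot⟩

section Pyramid

variable [IsStrictOrderedRing 𝕜]

theorem linked_insert_of_apply_eq (hA : ∀ a ∈ A, f a = s)
    (hV : IsFullVertexSet 𝕜 S (insert v A)) (hv : f v ≠ s) (hpS : p ∈ S) (hpv : f p = f v) :
    Linked 𝕜 S (insert v A) (insert p A) := by
  obtain rfl | hne := eq_or_ne p v
  · exact .refl hV
  have := nontrivial_of_ne p v hne
  have hp : affineSpan 𝕜 (insert p A) = ⊤ :=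
    affineSpan_insert_eq_top_of_layer hA hV.affineSpan_eq_top (hpv ▸ hv)
  have hAi : ConvexIndependent 𝕜 ((↑) : A → E) := hV.convexIndependent.mono (Set.subset_insert v A)
  refine .of_subset (W := {p, v} ∪ A) ⟨?_, ?_, ?_⟩ (by grind) (by grind) hV.affineSpan_eq_top hp
  · have := hV.subset
    grind
  · exact convexIndependent_union_of_layers hv (by grind) hA (convexIndependent_pair hne) hAi
  · exact affineSpan_eq_top_mono (by grind) hp

theorem linked_insert_of_pair (hA : ∀ a ∈ A, f a = s) (hV : IsFullVertexSet 𝕜 S (insert p A))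
    (hqS : q ∈ S) (hpq : 0 < (f p - s) * (f q - s)) (hgp : ∀ a ∈ A, g p ≤ g a)
    (hgq : ∀ a ∈ A, g a ≤ g q) (hlt : g p < g q) :
    Linked 𝕜 S (insert p A) (insert q A) := by
  have := nontrivial_of_ne p q (ne_of_apply_ne g hlt.ne)
  have hq : f q ≠ s := fun h => by simp [h] at hpq
  have hq' : affineSpan 𝕜 (insert q A) = ⊤ :=
    affineSpan_insert_eq_top_of_layer hA hV.affineSpan_eq_top hq
  have hAi : ConvexIndependent 𝕜 ((↑) : A → E) := hV.convexIndependent.mono (Set.subset_insert p A)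
  refine .of_subset (W := A ∪ {p, q}) ⟨?_, ?_, ?_⟩ (by grind) (by grind) hV.affineSpan_eq_top hq'
  · have := hV.subset
    grind
  · exact convexIndependent_union_pair hA hAi hpq hgp hgq hlt
  · exact affineSpan_eq_top_mono (by grind) hq'

end Pyramid

end Linked

section Update

variable {ι α : Type*} [DecidableEq ι]

theorem exists_forall_of_update [Finite ι] {R : (ι → α) → Prop} {T : ι → α → Prop}
    (hstep : ∀ F u, R F → ¬ T u (F u) → ∃ x, T u x ∧ R (Function.update F u x)) {F : ι → α}
    (hF : R F) : ∃ F', R F' ∧ ∀ j, T j (F' j) := by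
  suffices ∀ s : Set ι, ∃ F', R F' ∧ ∀ j ∈ s, T j (F' j) by simpa using this Set.univ
  intro s
  induction s, s.toFinite using Set.Finite.induction_on with
  | empty => exact ⟨F, hF, by simp⟩
  | @insert u s hus _ ih =>
    obtain ⟨F', hF', hs⟩ := ih
    by_cases hu : T u (F' u)
    · exact ⟨F', hF', Set.forall_mem_insert.2 ⟨hu, hs⟩⟩
    · obtain ⟨x, hx, hR⟩ := hstep F' u hF' hu
      refine ⟨_, hR, Set.forall_mem_insert.2 ⟨by simpa using hx, fun j hj => ?_⟩⟩
      rw [Function.update_of_ne (ne_of_mem_of_not_mem hj hus)]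
      exact hs j hj

end Update

section AffineBasis

variable {ι 𝕜 E : Type*} [Field 𝕜] [AddCommGroup E] [Module 𝕜 E]

theorem exists_affineBasis_update [Finite ι] [DecidableEq ι] (b : AffineBasis ι 𝕜 E) {x : E}
    {u : ι} (hu : b.coord u x ≠ 0) :
    ∃ b' : AffineBasis ι 𝕜 E, ⇑b' = Function.update b u x := by
  have := Fintype.ofFinite ι
  have := b.finiteDimensional
  have hind : AffineIndependent 𝕜 (Function.update b u x) := by
    refine b.ind.affineIndependent_update_of_notMem_affineSpan fun h => hu ?_
    refine AffineMap.eqOn_affineSpan (f := b.coord u) (g := AffineMap.const 𝕜 E 0) ?_ h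
    rintro _ ⟨l, hl, rfl⟩
    exact b.coord_apply_ne (Ne.symm hl)
  exact ⟨⟨Function.update b u x, hind,
    hind.affineSpan_eq_top_iff_card_eq_finrank_add_one.2 b.card_eq_finrank_add_one⟩, rfl⟩

/-- The rate of change of the `j`-th barycentric coordinate of a point sliding along `e`. -/
noncomputable def coordSlope (b : AffineBasis ι 𝕜 E) (e : E) (j : ι) : 𝕜 :=
  (b.coord j).linear e

variable {b b' : AffineBasis ι 𝕜 E} {e : E} {t : 𝕜} {u : ι}

theorem coord_add_smul (b : AffineBasis ι 𝕜 E) (e y : E) (t : 𝕜) (j : ι) :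
    b.coord j (y + t • e) = b.coord j y + t * coordSlope b e j := by
  rw [add_comm, ← vadd_eq_add, AffineMap.map_vadd, map_smul, vadd_eq_add, smul_eq_mul, add_comm,
    coordSlope]

theorem coordSlope_neg (b : AffineBasis ι 𝕜 E) (e : E) (j : ι) :
    coordSlope b (-e) j = -coordSlope b e j :=
  map_neg _ _

theorem sum_coordSlope [Fintype ι] (b : AffineBasis ι 𝕜 E) (e : E) : ∑ j, coordSlope b e j = 0 := by
  have h : ∑ j, b.coord j (0 + (1 : 𝕜) • e) = 1 := b.sum_coord_apply_eq_one _
  simpa only [coord_add_smul, Finset.sum_add_distrib, b.sum_coord_apply_eq_one, one_mul,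
    add_eq_left] using h

theorem sum_coordSlope_smul [Fintype ι] (b : AffineBasis ι 𝕜 E) (e : E) :
    ∑ j, coordSlope b e j • b j = e := by
  have h := b.linear_combination_coord_eq_self (0 + (1 : 𝕜) • e)
  simp_rw [coord_add_smul, add_smul, Finset.sum_add_distrib] at h
  simpa only [b.linear_combination_coord_eq_self, one_mul, one_smul, zero_add] using h

theorem linear_eq_sum_coordSlope [Fintype ι] (b : AffineBasis ι 𝕜 E) (e : E) (φ : E →ᵃ[𝕜] 𝕜) :
    φ.linear e = ∑ j, coordSlope b e j * φ (b j) := by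
  have hφ (j : ι) : φ (b j) = φ.linear (b j) + φ 0 := congrFun φ.decomp (b j)
  simp only [hφ, mul_add, Finset.sum_add_distrib, ← Finset.sum_mul, sum_coordSlope, zero_mul,
    add_zero]
  conv_lhs => rw [← sum_coordSlope_smul b e]
  simp only [map_sum, map_smul, smul_eq_mul]

theorem coordSlope_update [Finite ι] [DecidableEq ι] (hb' : ⇑b' = Function.update b u (b u + t • e))
    (hu : 1 + t * coordSlope b e u ≠ 0) (j : ι) :
    coordSlope b' e j = (1 + t * coordSlope b e u)⁻¹ * coordSlope b e j := by
  have := Fintype.ofFinite ι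
  have hcoord (l : ι) : b'.coord j (b l) =
      (if j = l then 1 else 0) - if l = u then t * coordSlope b' e j else 0 := by
    obtain rfl | hl := eq_or_ne l u
    · have h : b'.coord j (b' l) = b'.coord j (b l + t • e) := by rw [hb', Function.update_self]
      rw [coord_add_smul, b'.coord_apply] at h
      rw [if_pos rfl, h, add_sub_cancel_right]
    · rw [if_neg hl, sub_zero, ← b'.coord_apply, hb', Function.update_of_ne hl]
  have hslope : coordSlope b' e j = ∑ l, coordSlope b e l * b'.coord j (b l) :=
    linear_eq_sum_coordSlope b e (b'.coord j)
  simp only [hcoord, mul_sub, mul_ite, mul_one, mul_zero, Finset.sum_sub_distrib,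
    Finset.sum_ite_eq, Finset.sum_ite_eq', Finset.mem_univ, if_true] at hslope
  rw [eq_inv_mul_iff_mul_eq₀ hu]
  linear_combination hslope

theorem exists_coordSlope_ne_zero [Finite ι] (he : e ≠ 0) (b : AffineBasis ι 𝕜 E) :
    ∃ j, coordSlope b e j ≠ 0 := by
  have := Fintype.ofFinite ι
  by_contra! h
  refine he ?_
  rw [← sum_coordSlope_smul b e]
  simp only [h, zero_smul, Finset.sum_const_zero]

end AffineBasis

section Sliding

variable {ι 𝕜 E : Type*} [Field 𝕜] [LinearOrder 𝕜] [AddCommGroup E] [Module 𝕜 E]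
  {b b' : AffineBasis ι 𝕜 E} {S : Set E} {f : E →ₗ[𝕜] 𝕜} {e x y : E} {t : 𝕜}
  {u : ι}

theorem isFullVertexSet_range (b : AffineBasis ι 𝕜 E) (hb : Set.range b ⊆ S) :
    IsFullVertexSet 𝕜 S (Set.range b) where
  subset := hb
  convexIndependent := (convexIndependent_of_affineIndependent b.ind).range
  affineSpan_eq_top := b.tot

variable [IsStrictOrderedRing 𝕜]

theorem convexIndependent_insert_range (b : AffineBasis ι 𝕜 E) {a a' c : ι} (haa : a ≠ a')
    (ha : 0 < b.coord a x) (ha' : 0 < b.coord a' x) (hc : b.coord c x < 0) :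
    ConvexIndependent 𝕜 ((↑) : ↥(insert x (Set.range b)) → E) := by
  classical
  rw [convexIndependent_set_iff_notMem_convexHull_sdiff]
  rintro v (rfl | ⟨u, rfl⟩)
  · refine notMem_convexHull_of_pos (φ := -b.coord c) ?_ (by simpa using hc)
    rintro _ ⟨rfl | ⟨l, rfl⟩, hne⟩
    · exact absurd rfl hne
    · simp only [AffineMap.coe_neg, Pi.neg_apply, b.coord_apply]
      split_ifs <;> simp
  · obtain ⟨w, hwu, hw⟩ : ∃ w, w ≠ u ∧ 0 < b.coord w x := by
      by_cases hau : a = u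
      · exact ⟨a', hau ▸ haa.symm, ha'⟩
      · exact ⟨a, hau, ha⟩
    -- The multiple of `b.coord w` is the smallest one for which the functional is nonpositive at
    -- both `x` and `b w`.
    have hφ (z : E) : (b.coord w x • b.coord u - max (b.coord u x) 0 • b.coord w) z =
      b.coord w x * b.coord u z - max (b.coord u x) 0 * b.coord w z := rfl
    refine notMem_convexHull_of_pos
      (φ := b.coord w x • b.coord u - max (b.coord u x) 0 • b.coord w) ?_ ?_
    · rintro z ⟨rfl | ⟨l, rfl⟩, hne⟩
      · rw [hφ]
        nlinarith [le_max_left (b.coord u z) 0]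
      · have hul : u ≠ l := by
          rintro rfl
          exact hne rfl
        rw [hφ, b.coord_apply_ne hul, b.coord_apply]
        have := le_max_right (b.coord u x) 0
        split_ifs <;> linarith
    · rw [hφ, b.coord_apply_eq, b.coord_apply_ne hwu]
      linarith

/-- A family of signs is mixed when it has at least two positive and at least two negative members:
for the slopes of a simplex, this is the case where every vertex can be slid to either side. -/
def IsMixed (g : ι → 𝕜) : Prop :=
  {j | 0 < g j}.Nontrivial ∧ {j | g j < 0}.Nontrivial

theorem IsMixed.const_mul {g : ι → 𝕜} (hg : IsMixed g) {r : 𝕜} (hr : r ≠ 0) :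
    IsMixed fun j => r * g j := by
  obtain hr | hr := hr.lt_or_gt
  · simpa only [IsMixed, ← smul_eq_mul, smul_pos_iff_of_neg_left hr, smul_neg_iff_of_neg_left hr]
      using hg.symm
  · simpa only [IsMixed, ← smul_eq_mul, smul_pos_iff_of_pos_left hr, smul_neg_iff_of_pos_left hr]
      using hg

variable [Finite ι]

theorem exists_pos_and_exists_neg_coordSlope (he : e ≠ 0) (b : AffineBasis ι 𝕜 E) :
    (∃ j, 0 < coordSlope b e j) ∧ ∃ j, coordSlope b e j < 0 := by
  have := Fintype.ofFinite ι
  obtain ⟨j, hj⟩ := exists_coordSlope_ne_zero he b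
  obtain ⟨p, -, hp⟩ := Finset.exists_pos_of_sum_zero_of_exists_nonzero _ (sum_coordSlope b e)
    ⟨j, Finset.mem_univ j, hj⟩
  obtain ⟨n, -, hn⟩ := Finset.exists_pos_of_sum_zero_of_exists_nonzero _ (sum_coordSlope b (-e))
    ⟨j, Finset.mem_univ j, by rwa [coordSlope_neg, neg_ne_zero]⟩
  rw [coordSlope_neg, neg_pos] at hn
  exact ⟨⟨p, hp⟩, ⟨n, hn⟩⟩

theorem isMixed_or_exists_unique_pos (he : e ≠ 0) (b : AffineBasis ι 𝕜 E) :
    IsMixed (coordSlope b e) ∨ ∃ e' ∈ ({e, -e} : Set E), ∃ p, 0 < coordSlope b e' p ∧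
      ∀ j ≠ p, coordSlope b e' j ≤ 0 := by
  obtain ⟨⟨p, hp⟩, ⟨n, hn⟩⟩ := exists_pos_and_exists_neg_coordSlope he b
  by_cases hpos : {j | 0 < coordSlope b e j}.Nontrivial
  · by_cases hneg : {j | coordSlope b e j < 0}.Nontrivial
    · exact Or.inl ⟨hpos, hneg⟩
    · refine Or.inr ⟨-e, by simp, n, by simpa [coordSlope_neg] using hn, fun j hj => ?_⟩
      rw [coordSlope_neg, neg_nonpos]
      exact not_lt.1 fun h => hneg ⟨j, h, n, hn, hj⟩
  · exact Or.inr ⟨e, by simp, p, hp, fun j hj => not_lt.1 fun h => hpos ⟨j, h, p, hp, hj⟩⟩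

theorem exists_linked_update [DecidableEq ι] (hb : Set.range b ⊆ S) (hx : x ∈ S)
    (hu : b.coord u x ≠ 0) {a a' c : ι} (haa : a ≠ a') (ha : 0 < b.coord a x)
    (ha' : 0 < b.coord a' x) (hc : b.coord c x < 0) :
    ∃ b' : AffineBasis ι 𝕜 E, ⇑b' = Function.update b u x ∧
      Linked 𝕜 S (Set.range b) (Set.range b') := by
  obtain ⟨b', hb'⟩ := exists_affineBasis_update b hu
  refine ⟨b', hb', .of_subset (W := insert x (Set.range b)) ⟨Set.insert_subset hx hb,
    convexIndependent_insert_range b haa ha ha' hc,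
    affineSpan_eq_top_mono (Set.subset_insert x _) b.tot⟩ (Set.subset_insert x _) ?_ b.tot b'.tot⟩
  rintro _ ⟨j, rfl⟩
  obtain rfl | hj := eq_or_ne j u
  · simp [hb']
  · exact Or.inr ⟨j, by simp [hb', hj]⟩

theorem exists_linked_update_of_pos [DecidableEq ι] (hb : Set.range b ⊆ S) (hx : b u + t • e ∈ S)
    (hu : 0 < 1 + t * coordSlope b e u) {a c : ι} (hau : a ≠ u)
    (ha : 0 < t * coordSlope b e a) (hcu : c ≠ u) (hc : t * coordSlope b e c < 0) :
    ∃ b' : AffineBasis ι 𝕜 E, ⇑b' = Function.update b u (b u + t • e) ∧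
      Linked 𝕜 S (Set.range b) (Set.range b') := by
  have hu' : 0 < b.coord u (b u + t • e) := by rwa [coord_add_smul, b.coord_apply_eq]
  refine exists_linked_update hb hx hu'.ne' hau.symm hu' (a' := a) (c := c) ?_ ?_
  · rwa [coord_add_smul, b.coord_apply_ne hau, zero_add]
  · rwa [coord_add_smul, b.coord_apply_ne hcu, zero_add]

theorem exists_linked_update_of_neg [DecidableEq ι] (hb : Set.range b ⊆ S) (hx : b u + t • e ∈ S)
    (hu : 1 + t * coordSlope b e u < 0) {a a' : ι} (haa : a ≠ a') (hau : a ≠ u) (hau' : a' ≠ u)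
    (ha : 0 < t * coordSlope b e a) (ha' : 0 < t * coordSlope b e a') :
    ∃ b' : AffineBasis ι 𝕜 E, ⇑b' = Function.update b u (b u + t • e) ∧
      Linked 𝕜 S (Set.range b) (Set.range b') := by
  have hu' : b.coord u (b u + t • e) < 0 := by rwa [coord_add_smul, b.coord_apply_eq]
  refine exists_linked_update hb hx hu'.ne haa (c := u) ?_ ?_ hu'
  · rwa [coord_add_smul, b.coord_apply_ne hau, zero_add]
  · rwa [coord_add_smul, b.coord_apply_ne hau', zero_add]

theorem exists_linked_slide_of_unique_pos [DecidableEq ι] (hb : Set.range b ⊆ S) {p n u : ι}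
    (hp : 0 < coordSlope b e p) (hle : ∀ j ≠ p, coordSlope b e j ≤ 0)
    (hn : coordSlope b e n < 0) (hmin : ∀ j, coordSlope b e j < 0 → f (b n) ≤ f (b j))
    (hup : u ≠ p) (hun : f (b u) ≠ f (b n)) (hx : b u + (f (b n) - f (b u)) • e ∈ S) :
    ∃ b' : AffineBasis ι 𝕜 E, ⇑b' = Function.update b u (b u + (f (b n) - f (b u)) • e) ∧
      Linked 𝕜 S (Set.range b) (Set.range b') ∧
      ∃ r > 0, ∀ j, coordSlope b' e j = r * coordSlope b e j := by
  set t := f (b n) - f (b u)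
  have hnu : n ≠ u := fun h => hun (h ▸ rfl)
  obtain ⟨hu, a, c, hau, ha, hcu, hc⟩ : 0 < 1 + t * coordSlope b e u ∧ ∃ a c, a ≠ u ∧
      0 < t * coordSlope b e a ∧ c ≠ u ∧ t * coordSlope b e c < 0 := by
    obtain hlt | hgt := hun.symm.lt_or_gt
    · have ht : t < 0 := sub_neg.2 hlt
      have := mul_nonneg_of_nonpos_of_nonpos ht.le (hle u hup)
      exact ⟨by linarith, n, p, hnu, mul_pos_of_neg_of_neg ht hn, hup.symm,
        mul_neg_of_neg_of_pos ht hp⟩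
    · have ht : 0 < t := sub_pos.2 hgt
      have hu : coordSlope b e u = 0 :=
        (hle u hup).antisymm (not_lt.1 fun h => hgt.not_ge (hmin u h))
      exact ⟨by simp [hu], p, n, hup.symm, mul_pos ht hp, hnu, mul_neg_of_pos_of_neg ht hn⟩
  obtain ⟨b', hb', hlink⟩ := exists_linked_update_of_pos hb hx hu hau ha hcu hc
  exact ⟨b', hb', hlink, _, inv_pos.2 hu, coordSlope_update hb' hu.ne'⟩

theorem exists_linked_slide_of_isMixed [DecidableEq ι] (hb : Set.range b ⊆ S)
    (hmix : IsMixed (coordSlope b e)) (ht : t ≠ 0) (hu : 1 + t * coordSlope b e u ≠ 0)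
    (hx : b u + t • e ∈ S) :
    ∃ b' : AffineBasis ι 𝕜 E, ⇑b' = Function.update b u (b u + t • e) ∧
      Linked 𝕜 S (Set.range b) (Set.range b') ∧ IsMixed (coordSlope b' e) := by
  obtain ⟨b', hb', hlink⟩ : ∃ b' : AffineBasis ι 𝕜 E,
      ⇑b' = Function.update b u (b u + t • e) ∧ Linked 𝕜 S (Set.range b) (Set.range b') := by
    obtain ⟨hpos, hneg⟩ := hmix.const_mul ht
    obtain hu | hu := hu.lt_or_gt
    · obtain ⟨a, ha, a', ha', haa⟩ := hpos
      have hne {j : ι} (hj : 0 < t * coordSlope b e j) : j ≠ u := by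
        rintro rfl
        linarith
      exact exists_linked_update_of_neg hb hx hu haa (hne ha) (hne ha') ha ha'
    · obtain ⟨a, ha, hau⟩ := hpos.exists_ne u
      obtain ⟨c, hc, hcu⟩ := hneg.exists_ne u
      exact exists_linked_update_of_pos hb hx hu hau ha hcu hc
  refine ⟨b', hb', hlink, ?_⟩
  rw [funext (coordSlope_update hb' hu)]
  exact hmix.const_mul (inv_ne_zero hu)

theorem exists_linked_of_unique_pos (hfe : f e = 1)
    (hS : ∀ x ∈ S, ∀ y ∈ S, x + (f y - f x) • e ∈ S) (hb : Set.range b ⊆ S) {p : ι}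
    (hp : 0 < coordSlope b e p) (hle : ∀ j ≠ p, coordSlope b e j ≤ 0) :
    ∃ (b' : AffineBasis ι 𝕜 E) (l : 𝕜), Linked 𝕜 S (Set.range b) (Set.range b') ∧
      ∀ j ≠ p, f (b' j) = l := by
  classical
  have he : e ≠ 0 := by
    rintro rfl
    simp at hfe
  obtain ⟨n, hn, hmin⟩ := Set.exists_min_image {j | coordSlope b e j < 0} (fun j => f (b j))
    (Set.toFinite _) (exists_pos_and_exists_neg_coordSlope he b).2
  let R (F : ι → E) : Prop := ∃ b' : AffineBasis ι 𝕜 E, ⇑b' = F ∧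
    Linked 𝕜 S (Set.range b) (Set.range b') ∧ 0 < coordSlope b' e p ∧
    (∀ j ≠ p, coordSlope b' e j ≤ 0) ∧ (∃ m, coordSlope b' e m < 0 ∧ f (b' m) = f (b n)) ∧
    ∀ j, coordSlope b' e j < 0 → f (b n) ≤ f (b' j)
  let T (j : ι) (x : E) : Prop := j ≠ p → f x = f (b n)
  suffices hstep : ∀ F u, R F → ¬ T u (F u) → ∃ x, T u x ∧ R (Function.update F u x) by
    obtain ⟨_, ⟨b', rfl, hlink, -⟩, hT⟩ := exists_forall_of_update hstep
      ⟨b, rfl, .refl (isFullVertexSet_range b hb), hp, hle, ⟨n, hn, rfl⟩, hmin⟩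
    exact ⟨b', f (b n), hlink, hT⟩
  rintro _ u ⟨b', rfl, hlink, hp', hle', ⟨m, hm, hmn⟩, hmin'⟩ hTu
  obtain ⟨hup, hun⟩ := Classical.not_imp.1 hTu
  rw [← hmn] at hun hmin'
  have hmu : m ≠ u := fun h => hun (h ▸ rfl)
  have hb' := hlink.right.subset
  obtain ⟨b'', hb'', hlink', r, hr, hslope⟩ := exists_linked_slide_of_unique_pos hb' hp' hle' hm
    hmin' hup hun (hS _ (hb' ⟨u, rfl⟩) _ (hb' ⟨m, rfl⟩))
  have hfx : f (b' u + (f (b' m) - f (b' u)) • e) = f (b' m) := by simp [hfe]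
  refine ⟨_, fun _ => hfx.trans hmn, b'', hb'', hlink.trans hlink', ?_, fun j hj => ?_,
    ⟨m, ?_, ?_⟩, ?_⟩
  · exact hslope p ▸ mul_pos hr hp'
  · exact hslope j ▸ mul_nonpos_of_nonneg_of_nonpos hr.le (hle' j hj)
  · exact hslope m ▸ mul_neg_of_pos_of_neg hr hm
  · rw [hb'', Function.update_of_ne hmu, hmn]
  · intro j hj
    rw [hb'', ← hmn]
    obtain rfl | hju := eq_or_ne j u
    · rw [Function.update_self, hfx]
    · rw [Function.update_of_ne hju]
      exact hmin' j (neg_of_mul_neg_right (hslope j ▸ hj) hr.le)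

theorem exists_linked_of_isMixed (hfe : f e = 1)
    (hS : ∀ x ∈ S, ∀ y ∈ S, x + (f y - f x) • e ∈ S) (hx : x ∈ S) (hy : y ∈ S)
    (hxy : f x ≠ f y) (hb : Set.range b ⊆ S) (hmix : IsMixed (coordSlope b e)) :
    ∃ b' : AffineBasis ι 𝕜 E, Linked 𝕜 S (Set.range b) (Set.range b') ∧
      ∀ j, (f (b' j) = f x ∨ f (b' j) = f y) ∧ ∃ r : 𝕜, b' j = b j + r • e := by
  classical
  let R (F : ι → E) : Prop := ∃ b' : AffineBasis ι 𝕜 E, ⇑b' = F ∧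
    Linked 𝕜 S (Set.range b) (Set.range b') ∧ IsMixed (coordSlope b' e) ∧
    ∀ j, ∃ r : 𝕜, b' j = b j + r • e
  let T (_ : ι) (z : E) : Prop := f z = f x ∨ f z = f y
  suffices hstep : ∀ F u, R F → ¬ T u (F u) → ∃ z, T u z ∧ R (Function.update F u z) by
    obtain ⟨_, ⟨b', rfl, hlink, -, hr⟩, hT⟩ := exists_forall_of_update hstep
      ⟨b, rfl, .refl (isFullVertexSet_range b hb), hmix, fun j => ⟨0, by simp⟩⟩
    exact ⟨b', hlink, fun j => ⟨hT j, hr j⟩⟩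
  rintro _ u ⟨b', rfl, hlink, hmix', hr⟩ hTu
  obtain ⟨hux, huy⟩ := not_or.1 hTu
  have hb' := hlink.right.subset
  obtain ⟨z, hzS, hz, hzu, hu⟩ : ∃ z ∈ S, (f z = f x ∨ f z = f y) ∧ f z - f (b' u) ≠ 0 ∧
      1 + (f z - f (b' u)) * coordSlope b' e u ≠ 0 := by
    by_contra! h
    have hx' := h x hx (Or.inl rfl) (sub_ne_zero.2 (Ne.symm hux))
    have hy' := h y hy (Or.inr rfl) (sub_ne_zero.2 (Ne.symm huy))
    have hslope : (f x - f y) * coordSlope b' e u = 0 := by linear_combination hx' - hy'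
    rw [(mul_eq_zero.1 hslope).resolve_left (sub_ne_zero.2 hxy)] at hx'
    simp at hx'
  obtain ⟨b'', hb'', hlink', hmix''⟩ := exists_linked_slide_of_isMixed hb' hmix' hzu hu
    (hS _ (hb' ⟨u, rfl⟩) _ hzS)
  refine ⟨_, ?_, b'', hb'', hlink.trans hlink', hmix'', fun j => ?_⟩
  · simpa [T, hfe] using hz
  · obtain ⟨r, hr⟩ := hr j
    rw [hb'']
    obtain rfl | hju := eq_or_ne j u
    · exact ⟨r + (f z - f (b' j)), by rw [Function.update_self, hr, add_smul, add_assoc]⟩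
    · exact ⟨r, by rw [Function.update_of_ne hju, hr]⟩

end Sliding

section Cube

variable {d k : ℕ} {A V : Set (Fin d → ℝ)} {x y : Fin d → ℝ}

theorem hypercube_eq_pi (d k : ℕ) : hypercube d k = Set.univ.pi fun _ => Set.Icc 0 (k : ℝ) := by
  ext x
  simp only [hypercube, Set.mem_ofPred_eq, Set.mem_univ_pi, Set.mem_Icc]

theorem convex_hypercube (d k : ℕ) : Convex ℝ (hypercube d k) :=
  hypercube_eq_pi d k ▸ convex_pi fun _ _ => convex_Icc 0 (k : ℝ)

/-- The lattice points of the hypercube `[0,k]^d`. -/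
def latticeCube (d k : ℕ) : Set (Fin d → ℝ) :=
  Set.univ.pi fun _ => ((↑) : ℤ → ℝ) '' Set.Icc 0 (k : ℤ)

theorem finite_latticeCube (d k : ℕ) : (latticeCube d k).Finite :=
  Set.Finite.pi fun _ => (Set.finite_Icc 0 (k : ℤ)).image _

theorem mem_latticeCube_iff :
    x ∈ latticeCube d k ↔ x ∈ hypercube d k ∧ ∃ z : Fin d → ℤ, x = fun i => (z i : ℝ) := by
  constructor
  · intro hx
    choose z hz hzx using fun i => hx i trivial
    refine ⟨fun i => ?_, z, funext fun i => (hzx i).symm⟩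
    rw [← hzx i]
    exact_mod_cast hz i
  · rintro ⟨hx, z, rfl⟩ i -
    obtain ⟨h0, h1⟩ := hx i
    dsimp only at h0 h1
    exact ⟨z i, ⟨by exact_mod_cast h0, by exact_mod_cast h1⟩, rfl⟩

theorem add_smul_single_mem_latticeCube (hx : x ∈ latticeCube d k) (hy : y ∈ latticeCube d k)
    (i : Fin d) : x + (y i - x i) • Pi.single i 1 ∈ latticeCube d k := by
  intro l _
  obtain rfl | hl := eq_or_ne l i
  · simpa using hy l trivial
  · simpa [hl] using hx l trivial

/-- The vertices of the hypercube `[0,k]^d`. -/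
def cubeCorners (d k : ℕ) : Set (Fin d → ℝ) :=
  Set.univ.pi fun _ => {0, (k : ℝ)}

/-- The vertices of the hypercube `[0,k]^d` with `i`-th coordinate `m`. They form a facet of the
hypercube when `m` is `0` or `k`, and there are none otherwise. -/
def facetCorners {d : ℕ} (k : ℕ) (i : Fin d) (m : ℝ) : Set (Fin d → ℝ) :=
  {y ∈ cubeCorners d k | y i = m}

theorem cubeCorners_subset_latticeCube (d k : ℕ) : cubeCorners d k ⊆ latticeCube d k :=
  Set.pi_mono fun _ _ => Set.insert_subset ⟨0, by simp⟩ (Set.singleton_subset_iff.2 ⟨k, by simp⟩)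

theorem update_mem_cubeCorners (hy : y ∈ cubeCorners d k) {m : ℝ} (hm : m ∈ ({0, (k : ℝ)} : Set ℝ))
    (i : Fin d) : Function.update y i m ∈ cubeCorners d k := by
  intro l _
  obtain rfl | hl := eq_or_ne l i
  · simpa using hm
  · simpa [hl] using hy l trivial

theorem convexHull_cubeCorners (d k : ℕ) : convexHull ℝ (cubeCorners d k) = hypercube d k := by
  rw [hypercube_eq_pi, cubeCorners, convexHull_pi]
  simp [convexHull_pair, segment_eq_Icc]

theorem extremePoints_hypercube (d k : ℕ) :
    (hypercube d k).extremePoints ℝ = cubeCorners d k := by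
  rw [hypercube_eq_pi, extremePoints_pi]
  simp [cubeCorners, Set.extremePoints_Icc]

theorem affineSpan_cubeCorners (d : ℕ) (hk : 0 < k) : affineSpan ℝ (cubeCorners d k) = ⊤ := by
  rw [← interior_convexHull_nonempty_iff_affineSpan_eq_top, convexHull_cubeCorners,
    hypercube_eq_pi, interior_pi_set Set.finite_univ, Set.univ_pi_nonempty_iff]
  simp [hk]

theorem isFullVertexSet_cubeCorners (d : ℕ) (hk : 0 < k) :
    IsFullVertexSet ℝ (latticeCube d k) (cubeCorners d k) where
  subset := cubeCorners_subset_latticeCube d k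
  convexIndependent :=
    extremePoints_hypercube d k ▸ (convex_hypercube d k).convexIndependent_extremePoints
  affineSpan_eq_top := affineSpan_cubeCorners d hk

theorem facetCorners_union_facetCorners (i : Fin d) {m n : ℝ}
    (hmn : ({m, n} : Set ℝ) = {0, (k : ℝ)}) :
    facetCorners k i m ∪ facetCorners k i n = cubeCorners d k := by
  ext y
  have hy (h : y ∈ cubeCorners d k) : y i ∈ ({m, n} : Set ℝ) := hmn ▸ h i trivial
  simp only [facetCorners, Set.mem_union, Set.mem_ofPred_eq]
  grind

theorem affineSpan_insert_facetCorners (hk : 0 < k) {i : Fin d} {m : ℝ}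
    (hm : m ∈ ({0, (k : ℝ)} : Set ℝ)) (hx : x i ≠ m) :
    affineSpan ℝ (insert x (facetCorners k i m)) = ⊤ := by
  have : Nontrivial (Fin d → ℝ) := nontrivial_of_ne x (fun _ => m) (ne_of_apply_ne (· i) hx)
  have hk' : (0 : ℝ) ≠ k := by positivity
  obtain ⟨n, hn, hnm⟩ := (Set.nontrivial_pair hk').exists_ne m
  let q : Fin d → ℝ := fun _ => m
  have hfacet {y : Fin d → ℝ} (hy : y ∈ cubeCorners d k) :
      Function.update y i m ∈ facetCorners k i m := ⟨update_mem_cubeCorners hy hm i, by simp⟩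
  have hq : q ∈ facetCorners k i m := ⟨fun _ _ => hm, rfl⟩
  set T := affineSpan ℝ (insert (Function.update q i n) (facetCorners k i m))
  have hT : T = ⊤ := by
    rw [← top_le_iff, ← affineSpan_cubeCorners d hk, affineSpan_le]
    intro y hy
    by_cases hyi : y i = m
    · exact subset_affineSpan ℝ _ (Or.inr ⟨hy, hyi⟩)
    · have hyn : y i = n := by
        have : y i ∈ ({0, (k : ℝ)} : Set ℝ) := hy i trivial
        grind
      have hy' : y = (1 : ℝ) • (Function.update q i n - q) + Function.update y i m := by
        ext l
        obtain rfl | hl := eq_or_ne l i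
        · simp [q, hyn]
        · simp [hl]
      rw [hy']
      exact T.smul_vsub_vadd_mem 1 (subset_affineSpan ℝ _ (Or.inl rfl))
        (subset_affineSpan ℝ _ (Or.inr hq)) (subset_affineSpan ℝ _ (Or.inr (hfacet hy)))
  exact affineSpan_insert_eq_top_of_layer (f := LinearMap.proj i) (fun a ha => ha.2) hT hx

theorem exists_corner_linked_insert (hd : 2 ≤ d) (hk : 0 < k) {i : Fin d} {s : ℝ}
    (hA : ∀ a ∈ A, a i = s) (hx : x i ≠ s)
    (h : IsFullVertexSet ℝ (latticeCube d k) (insert x A)) :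
    ∃ q ∈ cubeCorners d k, q i ≠ s ∧ Linked ℝ (latticeCube d k) (insert x A) (insert q A) := by
  have : Nontrivial (Fin d) := Fin.nontrivial_iff_two_le.2 hd
  obtain ⟨j, hj⟩ := exists_ne i
  have hcube {a : Fin d → ℝ} (ha : a ∈ insert x A) : a ∈ hypercube d k :=
    (mem_latticeCube_iff.1 (h.subset ha)).1
  obtain ⟨m, hm, hms⟩ : ∃ m ∈ ({0, (k : ℝ)} : Set ℝ), 0 < (x i - s) * (m - s) := by
    obtain ⟨hx0, hxk⟩ := hcube (Set.mem_insert x A) i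
    obtain hlt | hgt := hx.lt_or_gt
    · exact ⟨0, Or.inl rfl, mul_pos_of_neg_of_neg (by linarith) (by linarith)⟩
    · exact ⟨k, Or.inr rfl, mul_pos (by linarith) (by linarith)⟩
  let p := x + (0 - x j) • Pi.single j 1
  let q := Function.update (fun _ => (k : ℝ)) i m
  have hp : p ∈ latticeCube d k := add_smul_single_mem_latticeCube (y := 0)
    (h.subset (Set.mem_insert x A)) (cubeCorners_subset_latticeCube d k (by simp [cubeCorners])) j
  have hpi : p i = x i := by simp [p, hj.symm]
  have hpj : p j = 0 := by simp [p]
  have hq : q ∈ cubeCorners d k := update_mem_cubeCorners (by simp [cubeCorners]) hm i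
  have hqj : q j = k := by simp [q, hj]
  have hqi : q i = m := by simp [q]
  have hxp : Linked ℝ (latticeCube d k) (insert x A) (insert p A) :=
    linked_insert_of_apply_eq (f := LinearMap.proj i) hA h hx hp hpi
  have hpq : Linked ℝ (latticeCube d k) (insert p A) (insert q A) := by
    refine linked_insert_of_pair (f := LinearMap.proj i) (g := LinearMap.proj j) hA hxp.right
      (cubeCorners_subset_latticeCube d k hq) ?_ (fun a ha => ?_) (fun a ha => ?_) ?_
    · simpa [hpi, hqi] using hms
    · simpa [hpj] using (hcube (Or.inr ha) j).1
    · simpa [hqj] using (hcube (Or.inr ha) j).2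
    · simpa [hpj, hqj] using hk
  refine ⟨q, hq, fun hqs => ?_, hxp.trans hpq⟩
  simp [← hqi, hqs] at hms

theorem exists_linked_union_facetCorners (hd : 2 ≤ d) (hk : 0 < k) {i : Fin d} {s : ℝ}
    (hA : ∀ a ∈ A, a i = s) (hx : x i ≠ s)
    (h : IsFullVertexSet ℝ (latticeCube d k) (insert x A)) :
    ∃ m ∈ ({0, (k : ℝ)} : Set ℝ), m ≠ s ∧
      Linked ℝ (latticeCube d k) (insert x A) (A ∪ facetCorners k i m) := by
  obtain ⟨q, hq, hqs, hlink⟩ := exists_corner_linked_insert hd hk hA hx h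
  have hqA : insert q A ⊆ A ∪ facetCorners k i (q i) :=
    Set.insert_subset (Or.inr ⟨hq, rfl⟩) Set.subset_union_left
  have hspan := affineSpan_eq_top_mono hqA hlink.right.affineSpan_eq_top
  refine ⟨q i, hq i trivial, hqs, hlink.trans (.of_subset ⟨?_, ?_, hspan⟩ hqA subset_rfl
    hlink.right.affineSpan_eq_top hspan)⟩
  · exact Set.union_subset ((Set.subset_insert x A).trans h.subset)
      ((Set.sep_subset _ _).trans (cubeCorners_subset_latticeCube d k))
  · exact convexIndependent_union_of_layers (f := LinearMap.proj i) hqs.symm hA (fun a ha => ha.2)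
      (h.convexIndependent.mono (Set.subset_insert x A))
      ((isFullVertexSet_cubeCorners d hk).convexIndependent.mono (Set.sep_subset _ _))

theorem linked_cubeCorners_of_pyramid (hd : 2 ≤ d) (hk : 0 < k) {i : Fin d} {s : ℝ}
    (hA : ∀ a ∈ A, a i = s) (hx : x i ≠ s)
    (h : IsFullVertexSet ℝ (latticeCube d k) (insert x A)) :
    Linked ℝ (latticeCube d k) (insert x A) (cubeCorners d k) := by
  have : Nontrivial (Fin d → ℝ) := nontrivial_of_ne x (fun _ => s) (ne_of_apply_ne (· i) hx)
  obtain ⟨m, hm, hms, hlink⟩ := exists_linked_union_facetCorners hd hk hA hx h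
  obtain ⟨u, hu⟩ := nonempty_of_affineSpan_insert_eq_top h.affineSpan_eq_top
  have hum : u i ≠ m := hA u hu ▸ hms.symm
  have hpyramid : Linked ℝ (latticeCube d k) (A ∪ facetCorners k i m)
      (insert u (facetCorners k i m)) :=
    .of_subset hlink.right subset_rfl (Set.insert_subset (Or.inl hu) Set.subset_union_right)
      hlink.right.affineSpan_eq_top (affineSpan_insert_facetCorners hk hm hum)
  obtain ⟨n, hn, hnm, hlink'⟩ :=
    exists_linked_union_facetCorners hd hk (fun a ha => ha.2) hum hpyramid.right
  rw [facetCorners_union_facetCorners i (by grind)] at hlink'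
  exact (hlink.trans hpyramid).trans hlink'

theorem linked_cubeCorners_of_forall_ne (hd : 2 ≤ d) (hk : 0 < k) {ι : Type*}
    {b : AffineBasis ι ℝ (Fin d → ℝ)} (hb : Set.range b ⊆ latticeCube d k) {i : Fin d} {p : ι}
    {s : ℝ} (hs : ∀ j ≠ p, b j i = s) :
    Linked ℝ (latticeCube d k) (Set.range b) (cubeCorners d k) := by
  have hrange : Set.range b = insert (b p) (b '' {p}ᶜ) := by
    rw [← Set.image_insert_eq, Set.insert_eq, Set.union_compl_self, Set.image_univ]
  have hproj : LinearMap.proj (R := ℝ) (φ := fun _ : Fin d => ℝ) i ≠ 0 := fun h => by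
    simpa using LinearMap.congr_fun h 1
  obtain ⟨_, ⟨j, rfl⟩, hj⟩ := exists_mem_apply_ne hproj b.tot s
  obtain rfl : j = p := not_not.1 fun hjp => hj (hs j hjp)
  rw [hrange]
  exact linked_cubeCorners_of_pyramid hd hk (Set.forall_mem_image.2 hs) hj
    (hrange ▸ isFullVertexSet_range b hb)

theorem linked_cubeCorners_or_exists_linked (hd : 2 ≤ d) (hk : 0 < k) {ι : Type*} [Finite ι]
    {b : AffineBasis ι ℝ (Fin d → ℝ)} (hb : Set.range b ⊆ latticeCube d k) (i : Fin d) :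
    Linked ℝ (latticeCube d k) (Set.range b) (cubeCorners d k) ∨
      ∃ b' : AffineBasis ι ℝ (Fin d → ℝ), Linked ℝ (latticeCube d k) (Set.range b) (Set.range b') ∧
        ∀ j, b' j i ∈ ({0, (k : ℝ)} : Set ℝ) ∧ ∀ l ≠ i, b' j l = b j l := by
  let f : (Fin d → ℝ) →ₗ[ℝ] ℝ := LinearMap.proj i
  have hS : ∀ x ∈ latticeCube d k, ∀ y ∈ latticeCube d k,
      x + (f y - f x) • Pi.single i 1 ∈ latticeCube d k :=
    fun x hx y hy => add_smul_single_mem_latticeCube hx hy i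
  have hconst {c : ℝ} (hc : c ∈ ({0, (k : ℝ)} : Set ℝ)) : (fun _ => c) ∈ latticeCube d k :=
    cubeCorners_subset_latticeCube d k fun _ _ => hc
  have he : (Pi.single i 1 : Fin d → ℝ) ≠ 0 := by simp
  obtain hmix | ⟨e', he', p, hp, hle⟩ := isMixed_or_exists_unique_pos he b
  · obtain ⟨b', hlink, hb'⟩ := exists_linked_of_isMixed (f := f) (by simp [f]) hS
      (hconst (Or.inl rfl)) (hconst (Or.inr rfl)) (by simpa [f, eq_comm] using hk.ne') hb hmix
    refine Or.inr ⟨b', hlink, fun j => ⟨(hb' j).1, fun l hl => ?_⟩⟩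
    obtain ⟨r, hr⟩ := (hb' j).2
    simp [hr, hl]
  · left
    obtain ⟨b', s, hlink, hs⟩ : ∃ (b' : AffineBasis ι ℝ (Fin d → ℝ)) (s : ℝ),
        Linked ℝ (latticeCube d k) (Set.range b) (Set.range b') ∧ ∀ j ≠ p, b' j i = s := by
      obtain rfl | rfl := he'
      · exact exists_linked_of_unique_pos (f := f) (by simp [f]) hS hb hp hle
      · obtain ⟨b', s, hlink, hs⟩ := exists_linked_of_unique_pos (f := -f) (by simp [f])
          (fun x hx y hy => by simpa [neg_add_eq_sub, ← neg_smul] using hS x hx y hy) hb hp hle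
        exact ⟨b', -s, hlink, fun j hj => neg_eq_iff_eq_neg.1 (hs j hj)⟩
    exact hlink.trans (linked_cubeCorners_of_forall_ne hd hk hlink.right.subset hs)

theorem linked_cubeCorners_range (hd : 2 ≤ d) (hk : 0 < k) {ι : Type*} [Finite ι]
    {b : AffineBasis ι ℝ (Fin d → ℝ)} (hb : Set.range b ⊆ latticeCube d k) :
    Linked ℝ (latticeCube d k) (Set.range b) (cubeCorners d k) := by
  suffices haxes : ∀ s : Finset (Fin d),
      Linked ℝ (latticeCube d k) (Set.range b) (cubeCorners d k) ∨
      ∃ b' : AffineBasis ι ℝ (Fin d → ℝ), Linked ℝ (latticeCube d k) (Set.range b) (Set.range b') ∧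
        ∀ i ∈ s, ∀ j, b' j i ∈ ({0, (k : ℝ)} : Set ℝ) by
    obtain h | ⟨b', hlink, hb'⟩ := haxes Finset.univ
    · exact h
    · refine hlink.trans (.of_subset (isFullVertexSet_cubeCorners d hk) ?_ subset_rfl b'.tot
        (affineSpan_cubeCorners d hk))
      rintro _ ⟨j, rfl⟩ i -
      exact hb' i (Finset.mem_univ i) j
  intro s
  induction s using Finset.induction_on with
  | empty => exact Or.inr ⟨b, .refl (isFullVertexSet_range b hb), by simp⟩
  | insert i s his ih =>
    obtain h | ⟨b', hlink, hb'⟩ := ih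
    · exact Or.inl h
    obtain h | ⟨b'', hlink', hb''⟩ := linked_cubeCorners_or_exists_linked hd hk hlink.right.subset i
    · exact Or.inl (hlink.trans h)
    refine Or.inr ⟨b'', hlink.trans hlink', (Finset.forall_mem_insert ..).2
      ⟨fun j => (hb'' j).1, fun l hl j => ?_⟩⟩
    rw [(hb'' j).2 l (ne_of_mem_of_not_mem hl his)]
    exact hb' l hl j

theorem linked_cubeCorners (hd : 2 ≤ d) (hk : 0 < k)
    (hV : IsFullVertexSet ℝ (latticeCube d k) V) :
    Linked ℝ (latticeCube d k) V (cubeCorners d k) := by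
  obtain ⟨W, b, hlink⟩ := exists_linked_range hV
  have := b.finite
  exact hlink.trans (linked_cubeCorners_range hd hk hlink.right.subset)

end Cube

section ExtremePoints

variable {E : Type*} [AddCommGroup E] [Module ℝ E] [TopologicalSpace E] [IsTopologicalAddGroup E]
  [ContinuousSMul ℝ E] [LocallyConvexSpace ℝ E] [T2Space E] {A : Set E}

theorem convexHull_extremePoints_convexHull (hA : A.Finite) :
    convexHull ℝ ((convexHull ℝ A).extremePoints ℝ) = convexHull ℝ A := by
  have hfin : ((convexHull ℝ A).extremePoints ℝ).Finite := hA.subset extremePoints_convexHull_subset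
  rw [← (hfin.isClosed_convexHull ℝ).closure_eq]
  exact closure_convexHull_extremePoints (hA.isCompact_convexHull ℝ) (convex_convexHull ℝ A)

theorem extremePoints_convexHull_eq_of_convexIndependent (hA : A.Finite)
    (hAi : ConvexIndependent ℝ ((↑) : A → E)) : (convexHull ℝ A).extremePoints ℝ = A := by
  refine extremePoints_convexHull_subset.antisymm fun v hv => by_contra fun hne => ?_
  refine convexIndependent_set_iff_notMem_convexHull_sdiff.1 hAi v hv ?_
  refine convexHull_mono (Set.subset_sdiff_singleton extremePoints_convexHull_subset hne) ?_
  rw [convexHull_extremePoints_convexHull hA]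
  exact subset_convexHull ℝ A hv

end ExtremePoints

section Graph

variable {d k : ℕ} {U V : Set (Fin d → ℝ)} {x : Fin d → ℝ}

namespace IsFullVertexSet

theorem finite (hV : IsFullVertexSet ℝ (latticeCube d k) V) : V.Finite :=
  (finite_latticeCube d k).subset hV.subset

theorem vertexSet_convexHull (hV : IsFullVertexSet ℝ (latticeCube d k) V) :
    vertexSet (convexHull ℝ V) = V :=
  extremePoints_convexHull_eq_of_convexIndependent hV.finite hV.convexIndependent

/-- The polytope with vertex set `V`, as a vertex of the graph `Λ(d,k)`. -/
def polytope (hV : IsFullVertexSet ℝ (latticeCube d k) V) :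
    {P : FullPolytope d | IsLatticePolytope P.1 ∧ P.1 ⊆ hypercube d k} where
  val := ⟨convexHull ℝ V, ⟨V, hV.finite, rfl⟩, by
    rw [IsFullDim, affineSpan_convexHull, hV.affineSpan_eq_top]⟩
  property :=
    ⟨fun v hv => (mem_latticeCube_iff.1 (hV.subset (hV.vertexSet_convexHull ▸ hv))).2,
      convexHull_min (fun v hv => (mem_latticeCube_iff.1 (hV.subset hv)).1)
        (convex_hypercube d k)⟩

theorem adj_polytope_insert (hV : IsFullVertexSet ℝ (latticeCube d k) V)
    (hxV : IsFullVertexSet ℝ (latticeCube d k) (insert x V)) (hx : x ∉ V) :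
    (latticePolytopeGraph d k).Adj hV.polytope hxV.polytope := by
  have hxhull : x ∉ convexHull ℝ V := by
    simpa [hx] using convexIndependent_set_iff_notMem_convexHull_sdiff.1 hxV.convexIndependent x
      (Set.mem_insert x V)
  have hhull : convexHull ℝ (convexHull ℝ V ∪ {x}) = convexHull ℝ (insert x V) := by
    rw [convexHull_convexHull_union_left, Set.union_singleton]
  have hmove : IsInsertionMove (convexHull ℝ V) (convexHull ℝ (insert x V)) := by
    refine ⟨x, ⟨hxhull, ?_⟩, hhull.symm⟩
    rw [hhull, hxV.vertexSet_convexHull, hV.vertexSet_convexHull, Set.union_singleton]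
  have hne : hV.polytope.1 ≠ hxV.polytope.1 := fun h => hxhull <| by
    rw [show convexHull ℝ V = convexHull ℝ (insert x V) from congrArg Subtype.val h]
    exact subset_convexHull ℝ _ (Set.mem_insert x V)
  exact ⟨hne, Or.inl (Or.inl hmove)⟩

theorem reachable_polytope_of_subset (hU : IsFullVertexSet ℝ (latticeCube d k) U)
    (hV : IsFullVertexSet ℝ (latticeCube d k) V) (hUV : U ⊆ V) :
    (latticePolytopeGraph d k).Reachable hU.polytope hV.polytope := by
  suffices ∀ D : Set (Fin d → ℝ), D.Finite → ∀ hD : IsFullVertexSet ℝ (latticeCube d k) (D ∪ U),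
      (latticePolytopeGraph d k).Reachable hU.polytope hD.polytope by
    have hreach := this V hV.finite
    rw [Set.union_eq_left.2 hUV] at hreach
    exact hreach hV
  intro D hD
  induction D, hD using Set.Finite.induction_on with
  | empty =>
    rw [Set.empty_union]
    exact fun _ => .refl _
  | @insert x D _ _ ih =>
    rw [Set.insert_union]
    by_cases hx : x ∈ D ∪ U
    · rwa [Set.insert_eq_of_mem hx]
    · intro hxD
      have hD := hxD.mono (Set.subset_insert x _)
        (affineSpan_eq_top_mono Set.subset_union_right hU.affineSpan_eq_top)
      exact (ih hD).trans (hD.adj_polytope_insert hxD hx).reachable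

end IsFullVertexSet

theorem Linked.reachable_polytope (h : Linked ℝ (latticeCube d k) U V) :
    (latticePolytopeGraph d k).Reachable h.left.polytope h.right.polytope := by
  have hstep {U V : Set (Fin d → ℝ)} (h : VertexCompatible ℝ (latticeCube d k) U V) :
      (latticePolytopeGraph d k).Reachable h.left.polytope h.symm.left.polytope :=
    (h.left.reachable_polytope_of_subset h.union Set.subset_union_left).trans
      (h.symm.left.reachable_polytope_of_subset h.union Set.subset_union_right).symm
  induction h with
  | single h => exact hstep h
  | tail _ h ih => exact ih.trans (hstep h)

theorem exists_polytope_eq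
    (P : {P : FullPolytope d | IsLatticePolytope P.1 ∧ P.1 ⊆ hypercube d k}) :
    ∃ (V : Set (Fin d → ℝ)) (hV : IsFullVertexSet ℝ (latticeCube d k) V), hV.polytope = P := by
  obtain ⟨⟨_, ⟨A, hA, rfl⟩, hfull⟩, hlattice, hcube⟩ := P
  have hhull := convexHull_extremePoints_convexHull hA
  refine ⟨vertexSet (convexHull ℝ A), ⟨fun v hv => ?_, ?_, ?_⟩,
    Subtype.ext (Subtype.ext hhull)⟩
  · exact mem_latticeCube_iff.2 ⟨hcube (extremePoints_subset hv), hlattice v hv⟩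
  · exact (convex_convexHull ℝ A).convexIndependent_extremePoints
  · rwa [← affineSpan_convexHull, vertexSet, hhull]

end Graph

theorem mainTheorem4 (d k : ℕ) (hd : 2 ≤ d) (hk : 0 < k) :
    (latticePolytopeGraph d k).Connected where
  nonempty := ⟨(isFullVertexSet_cubeCorners d hk).polytope⟩
  preconnected P Q := by
    obtain ⟨U, hU, rfl⟩ := exists_polytope_eq P
    obtain ⟨V, hV, rfl⟩ := exists_polytope_eq Q
    have hlink : Linked ℝ (latticeCube d k) U V :=
      (linked_cubeCorners hd hk hU).trans (linked_cubeCorners hd hk hV).symm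
    exact hlink.reachable_polytope
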